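/- Let $T,s\ge 1$ be integers, let $N_1,\dots,N_s$ and $K_1,K_2,\dots$ be nonnegative integers, $M_l=\sum_{k=1}^{l}(N_k+K_k)$ ($M_0=0$), and let $$S=\bigcup_{l=0}^{s-1}\{M_l,\dots,M_l+N_{l+1}-1\}\subset\mathbb Z$$ be the set of missed time points. Let $\vec a(j)\in\mathbb C^T$, $j\in S$, and $A(e^{i\lambda})=\sum_{j\in S}\vec a(j)e^{ij\lambda}$. The functional $\sum_{j\in S}\vec a(j)^\top\vec\zeta(j)$ of a $T$-variate stationary sequence $\vec\zeta$ is to be estimated from noise-free observations of $\vec\zeta(j)$, $j\in\mathbb Z\setminus S$. A spectral density is a $T\times T$ matrix function on $(-\pi,\pi]$ with integrable entries that is Hermitian nonnegative definite almost everywhere. For a spectral density $f$ let $L_2(f)$ be the space of measurable $\mathbb C^T$-valued functions $\vec b$ with $\int_{-\pi}^{\pi}\vec b^\top f\,\overline{\vec b}\,d\lambda<\infty$, and let $L_2^{s-}(f)$ be its closed subspace generated by the functions $e^{ij\lambda}\delta_\nu$, $j\in\mathbb Z\setminus S$, $\nu=1,\dots,T$, where $\delta_\nu$ are the standard basis vectors.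 For $\vec h\in L_2^{s-}(f)$ the mean square error of the linear estimate with spectral characteristic $\vec h$ is $$\Delta(\vec h;f)=\frac1{2\pi}\int_{-\pi}^{\pi}\bigl(A(e^{i\lambda})-\vec h(\lambda)\bigr)^\top f(\lambda)\,\overline{\bigl(A(e^{i\lambda})-\vec h(\lambda)\bigr)}\,d\lambda\in[0,\infty];$$ the same formula is used for every measurable $\vec h$. A spectral characteristic of the optimal estimate for $f$ is a minimizer of $\Delta(\cdot\,;f)$ over $L_2^{s-}(f)$, and $\Delta(f)=\min_{\vec h\in L_2^{s-}(f)}\Delta(\vec h;f)$. Let $D_f$ be a class of spectral densities and $H_D=\bigcap_{f\in D_f}L_2^{s-}(f)$. A density $f^0\in D_f$ is least favorable if $\Delta(f^0)=\max_{f\in D_f}\Delta(f)$. A function $\vec h^0\in H_D$ is a minimax (robust) spectral characteristic if $\max_{f\in D_f}\Delta(\vec h^0;f)$ exists and equals $\min_{\vec h\in H_D}\sup_{f\in D_f}\Delta(\vec h;f)$. Let $f^0\in D_f$ satisfy the minimality condition: $f^0(\lambda)$ is invertible for almost every $\lambda$ and $\int_{-\pi}^{\pi}\operatorname{Tr}\bigl[(f^0(\lambda))^{-1}\bigr]d\lambda<\infty$.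 Let $\mathbf B$ be the block matrix with the $T\times T$ blocks $$B(k,j)=\frac1{2\pi}\int_{-\pi}^{\pi}\bigl[(f^0(\lambda))^{-1}\bigr]^\top e^{i(j-k)\lambda}\,d\lambda,\qquad k,j\in S,$$ let $(\vec c(j))_{j\in S}=\mathbf B^{-1}(\vec a(j))_{j\in S}$, $C^0(e^{i\lambda})=\sum_{j\in S}\vec c(j)e^{ij\lambda}$, and let the function $\vec h(f^0)$ be given by $$\vec h(f^0)^\top=A(e^{i\lambda})^\top-C^0(e^{i\lambda})^\top (f^0(\lambda))^{-1}.\qquad(*)$$ Suppose that $f^0$ maximizes over $f\in D_f$ the linear functional $$\frac1{2\pi}\int_{-\pi}^{\pi}C^0(e^{i\lambda})^\top (f^0(\lambda))^{-1}f(\lambda)(f^0(\lambda))^{-1}\,\overline{C^0(e^{i\lambda})}\,d\lambda\in[0,\infty].$$ Then $f^0$ is least favorable in $D_f$. Moreover $\vec h(f^0)$ is a spectral characteristic of the optimal estimate for $f^0$, and $\Delta(\vec h(f^0);f)$ equals the above linear functional for every $f\in D_f$. If $\vec h(f^0)\in H_D$, then $\vec h(f^0)$ is a minimax spectral characteristic,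 and every minimax spectral characteristic coincides with it almost everywhere; that is, the minimax spectral characteristic is given by $(*)$. -/

import Mathlib

open scoped ComplexOrder

/-- Lebesgue measure on the interval `(-π, π]`. -/
noncomputable abbrev freqMeasure : MeasureTheory.Measure ℝ :=
  MeasureTheory.volume.restrict (Set.Ioc (-Real.pi) Real.pi)

/-- `M_l = ∑_{k=1}^{l} (N_k + K_k)` (so that `M_0 = 0`): the starting point of the `l`-th gap. -/
def gapStart (N K : ℕ → ℕ) (l : ℕ) : ℕ := ∑ k ∈ Finset.Icc 1 l, (N k + K k)

/-- The set of missed time points `S = ⋃_{l=0}^{s-1} {M_l, …, M_l + N_{l+1} - 1}`. -/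
noncomputable def missedPoints (s : ℕ) (N K : ℕ → ℕ) : Finset ℤ :=
  (Finset.range s).biUnion fun l =>
    Finset.Ico (gapStart N K l : ℤ) ((gapStart N K l : ℤ) + (N (l + 1) : ℤ))

/-- The character `e^{ijt}`. -/
noncomputable def expChar (j : ℤ) (t : ℝ) : ℂ := Complex.exp (Complex.I * (j : ℂ) * (t : ℂ))

/-- Spectral density matrices of `T`-variate stationary sequences: integrable on `(-π, π]` and
almost everywhere Hermitian nonnegative definite. -/
structure IsSpectralDensity {T : ℕ} (f : ℝ → Matrix (Fin T) (Fin T) ℂ) : Prop where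
  integrable : ∀ ν μ, MeasureTheory.Integrable (fun t => f t ν μ) freqMeasure
  posSemidef : ∀ᵐ t ∂freqMeasure, (f t).PosSemidef

/-- The minimality condition `∫ Tr (f(t))⁻¹ dt < ∞`, the matrix `f(t)` being invertible
for almost every `t`. -/
structure MinimalityCondition {T : ℕ} (f : ℝ → Matrix (Fin T) (Fin T) ℂ) : Prop where
  isUnit_det : ∀ᵐ t ∂freqMeasure, IsUnit (f t).det
  integrable_trace : MeasureTheory.Integrable (fun t => ((f t)⁻¹).trace) freqMeasure

/-- The squared norm `∫ b(t)ᵀ f(t) conj(b(t)) dt` of `L₂(f)`, as an extended nonnegative number. -/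
noncomputable def sqNorm {T : ℕ} (f : ℝ → Matrix (Fin T) (Fin T) ℂ) (b : ℝ → Fin T → ℂ) :
    ENNReal :=
  ∫⁻ t, ENNReal.ofReal ((b t ⬝ᵥ Matrix.mulVec (f t) (star (b t))).re) ∂freqMeasure

/-- The space `L₂(f)` of measurable vector functions with finite `∫ bᵀ f conj(b) dt`. -/
def spaceL2 {T : ℕ} (f : ℝ → Matrix (Fin T) (Fin T) ℂ) : Set (ℝ → Fin T → ℂ) :=
  {b | AEMeasurable b freqMeasure ∧ sqNorm f b < ⊤}

/-- The linear span of the functions `e^{ijt} δ_ν`, with `j ∉ S` and `ν = 1, …, T`. -/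
noncomputable def observedSpan (T : ℕ) (S : Finset ℤ) : Submodule ℂ (ℝ → Fin T → ℂ) :=
  Submodule.span ℂ {b | ∃ j : ℤ, j ∉ S ∧ ∃ ν : Fin T, b = fun t => Pi.single ν (expChar j t)}

/-- The closed subspace `L₂^{s-}(f)` of `L₂(f)` generated by the functions `e^{ijt} δ_ν`
with `j ∉ S`. -/
def observedL2 {T : ℕ} (S : Finset ℤ) (f : ℝ → Matrix (Fin T) (Fin T) ℂ) :
    Set (ℝ → Fin T → ℂ) :=
  {h | h ∈ spaceL2 f ∧
    ∀ ε : ENNReal, 0 < ε → ∃ p ∈ observedSpan T S, sqNorm f (h - p) < ε}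

/-- The vector trigonometric polynomial `∑_{j ∈ S} x(j) e^{ijt}`. -/
noncomputable def trigPoly {T : ℕ} (S : Finset ℤ) (x : ℤ → Fin T → ℂ) (t : ℝ) : Fin T → ℂ :=
  ∑ j ∈ S, expChar j t • x j

/-- The mean square error
`Δ(h; f) = (1/2π) ∫ (A(e^{it}) - h)ᵀ f(t) conj(A(e^{it}) - h) dt` of the linear estimate with
spectral characteristic `h` of the functional `∑_{j ∈ S} a(j)ᵀ ζ(j)`, when the sequence `ζ` is
observed without noise and has the spectral density `f`. -/
noncomputable def meanSqError {T : ℕ} (S : Finset ℤ) (a : ℤ → Fin T → ℂ)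
    (h : ℝ → Fin T → ℂ) (f : ℝ → Matrix (Fin T) (Fin T) ℂ) : ENNReal :=
  ENNReal.ofReal (1 / (2 * Real.pi)) * sqNorm f (trigPoly S a - h)

/-- The error `Δ(f) = min_h Δ(h; f)` of the optimal linear estimate, with `h` in `L₂^{s-}(f)`. -/
noncomputable def optimalError {T : ℕ} (S : Finset ℤ) (a : ℤ → Fin T → ℂ)
    (f : ℝ → Matrix (Fin T) (Fin T) ℂ) : ENNReal :=
  ⨅ h ∈ observedL2 S f, meanSqError S a h f

/-- `h` is a spectral characteristic of the optimal linear estimate for the density `f`. -/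
def IsOptimalChar {T : ℕ} (S : Finset ℤ) (a : ℤ → Fin T → ℂ)
    (f : ℝ → Matrix (Fin T) (Fin T) ℂ) (h : ℝ → Fin T → ℂ) : Prop :=
  h ∈ observedL2 S f ∧ ∀ h' ∈ observedL2 S f, meanSqError S a h f ≤ meanSqError S a h' f

/-- `f₀` is least favorable in the class `D`: `Δ(f₀) = max_{f ∈ D} Δ(f)`. -/
def IsLeastFavorable {T : ℕ} (S : Finset ℤ) (a : ℤ → Fin T → ℂ)
    (D : Set (ℝ → Matrix (Fin T) (Fin T) ℂ)) (f₀ : ℝ → Matrix (Fin T) (Fin T) ℂ) : Prop :=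
  f₀ ∈ D ∧ ∀ f ∈ D, optimalError S a f ≤ optimalError S a f₀

/-- `H_D = ⋂_{f ∈ D} L₂^{s-}(f)`. -/
def admissibleChars {T : ℕ} (S : Finset ℤ) (D : Set (ℝ → Matrix (Fin T) (Fin T) ℂ)) :
    Set (ℝ → Fin T → ℂ) :=
  ⋂ f ∈ D, observedL2 S f

/-- `h₀` is a minimax (robust) spectral characteristic for the class `D`: it lies in `H_D`,
the maximum of `Δ(h₀; f)` over `f ∈ D` is attained, and no `h ∈ H_D` has a smaller
`sup_{f ∈ D} Δ(h; f)`. -/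
def IsMinimaxChar {T : ℕ} (S : Finset ℤ) (a : ℤ → Fin T → ℂ)
    (D : Set (ℝ → Matrix (Fin T) (Fin T) ℂ)) (h₀ : ℝ → Fin T → ℂ) : Prop :=
  h₀ ∈ admissibleChars S D ∧
    ∃ f₁ ∈ D, (∀ f ∈ D, meanSqError S a h₀ f ≤ meanSqError S a h₀ f₁) ∧
      ∀ h ∈ admissibleChars S D, meanSqError S a h₀ f₁ ≤ ⨆ f ∈ D, meanSqError S a h f

/-- The block matrix `B`, with blocks
`B(k, j) = (1/2π) ∫ [(f(t))⁻¹]ᵀ e^{i(j-k)t} dt` for `k, j ∈ S`. -/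
noncomputable def blockMatrix {T : ℕ} (S : Finset ℤ) (f : ℝ → Matrix (Fin T) (Fin T) ℂ) :
    Matrix (S × Fin T) (S × Fin T) ℂ :=
  fun p q => (1 / (2 * (Real.pi : ℂ))) *
    ∫ t, (((f t)⁻¹).transpose p.2 q.2) * expChar ((q.1 : ℤ) - (p.1 : ℤ)) t ∂freqMeasure

/-- The coefficients `c(j)`, `j ∈ S`, of `c = B⁻¹ a` (extended by zero outside `S`). -/
noncomputable def optCoeff {T : ℕ} (S : Finset ℤ) (a : ℤ → Fin T → ℂ)
    (f : ℝ → Matrix (Fin T) (Fin T) ℂ) (j : ℤ) : Fin T → ℂ :=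
  fun ν => if hj : j ∈ S then
    Matrix.mulVec (blockMatrix S f)⁻¹ (fun p : S × Fin T => a (p.1 : ℤ) p.2) (⟨j, hj⟩, ν)
  else 0

/-- `C(e^{it}) = ∑_{j ∈ S} c(j) e^{ijt}`, where `c = B⁻¹ a`. -/
noncomputable def optPoly {T : ℕ} (S : Finset ℤ) (a : ℤ → Fin T → ℂ)
    (f : ℝ → Matrix (Fin T) (Fin T) ℂ) : ℝ → Fin T → ℂ :=
  trigPoly S (optCoeff S a f)

/-- The spectral characteristic `h(f)ᵀ = A(e^{it})ᵀ - C(e^{it})ᵀ (f(t))⁻¹`. -/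
noncomputable def specChar {T : ℕ} (S : Finset ℤ) (a : ℤ → Fin T → ℂ)
    (f : ℝ → Matrix (Fin T) (Fin T) ℂ) : ℝ → Fin T → ℂ :=
  fun t => trigPoly S a t - Matrix.vecMul (optPoly S a f t) (f t)⁻¹

/-- The linear functional
`f ↦ (1/2π) ∫ C⁰(e^{it})ᵀ (f₀(t))⁻¹ f(t) (f₀(t))⁻¹ conj(C⁰(e^{it})) dt`,
where `C⁰` is built from `f₀`; the integrand is nonnegative almost everywhere. -/
noncomputable def linFunctional {T : ℕ} (S : Finset ℤ) (a : ℤ → Fin T → ℂ)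
    (f₀ f : ℝ → Matrix (Fin T) (Fin T) ℂ) : ENNReal :=
  ENNReal.ofReal (1 / (2 * Real.pi)) *
    ∫⁻ t, ENNReal.ofReal
      ((Matrix.vecMul (optPoly S a f₀ t) ((f₀ t)⁻¹ * f t * (f₀ t)⁻¹)
        ⬝ᵥ star (optPoly S a f₀ t)).re) ∂freqMeasure

open MeasureTheory

section

variable {T : ℕ}

/-! The pair `(specChar S a f₀, f₀)` is a saddle point of the error `Δ(h; f)`.

If `R` is a Hermitian root of `f`, then `b ↦ bᵀR` carries `L₂(f)` isometrically into ordinary `L²`.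
A vector `z` is orthogonal to the image of the exponentials off `S` iff `zᵀR` has no Fourier
coefficients off `S`; by uniqueness of `L¹` Fourier coefficients, `zᵀR` is then a trigonometric
polynomial with frequencies in `S`. Hence an integrable element of `L₂(f)` whose coefficients vanish
on `S` is orthogonal to all such `z`, so it lies in the observed subspace
(`mem_observedL2_of_integral_expChar_mul_eq_zero`).

The equation `B c = a` says exactly that `h(f₀)` has vanishing coefficients on `S`. So `h(f₀)` lies
in the observed subspace of every `f` for which its error is finite. For `f₀` itself, `(A - h(f₀))ᵀ
f₀ = C⁰ᵀ` has frequencies in `S` only, so the error is orthogonal to that subspace. Pythagoras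
(`MinimalityCondition.sqNorm_trigPoly_sub`) gives optimality for `f₀`, and uniqueness because `f₀`
is invertible. Maximality of the linear functional at `f₀` is the other half of the saddle
inequality. -/

/-! ### Exponentials and uniqueness of Fourier coefficients in `L¹`. -/

theorem continuous_expChar (j : ℤ) : Continuous (expChar j) := by
  unfold expChar; fun_prop

theorem norm_expChar (j : ℤ) (t : ℝ) : ‖expChar j t‖ = 1 := by
  have : Complex.I * (j : ℂ) * (t : ℂ) = ((j * t : ℝ) : ℂ) * Complex.I := by push_cast; ring
  rw [expChar, this, Complex.norm_exp_ofReal_mul_I]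

theorem star_expChar (j : ℤ) (t : ℝ) : star (expChar j t) = expChar (-j) t := by
  simp only [expChar, Complex.star_def, ← Complex.exp_conj, map_mul, Complex.conj_I,
    Complex.conj_ofReal, map_intCast, Int.cast_neg]
  congr 1; ring

theorem expChar_add (i j : ℤ) (t : ℝ) : expChar (i + j) t = expChar i t * expChar j t := by
  simp only [expChar, ← Complex.exp_add, Int.cast_add]
  congr 1; ring

theorem expChar_zero (t : ℝ) : expChar 0 t = 1 := by simp [expChar]

theorem fourier_coe_eq_expChar (j : ℤ) (t : ℝ) :
    fourier j (t : AddCircle (2 * Real.pi)) = expChar j t := by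
  rw [fourier_coe_apply, expChar]
  congr 1
  have : (Real.pi : ℂ) ≠ 0 := by exact_mod_cast Real.pi_ne_zero
  push_cast
  field_simp

theorem integral_expChar (j : ℤ) :
    ∫ t, expChar j t ∂freqMeasure = if j = 0 then 2 * (Real.pi : ℂ) else 0 := by
  split_ifs with h
  · simp [h, expChar_zero, measureReal_def, ENNReal.toReal_ofReal, Real.pi_pos.le, two_mul]
  · rw [← intervalIntegral.integral_of_le (by linarith [Real.pi_pos])]
    have hj : Complex.I * (j : ℂ) ≠ 0 := by simp [h]
    have := integral_exp_mul_complex (a := -Real.pi) (b := Real.pi) hj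
    unfold expChar
    rw [this, div_eq_zero_iff]
    left
    rw [sub_eq_zero, Complex.exp_eq_exp_iff_exists_int]
    exact ⟨j, by push_cast; ring⟩

theorem MeasureTheory.Integrable.expChar_mul {v : ℝ → ℂ} (hv : Integrable v freqMeasure) (j : ℤ) :
    Integrable (fun t => expChar j t * v t) freqMeasure :=
  hv.bdd_mul (c := 1) (continuous_expChar j).aestronglyMeasurable
    (Filter.Eventually.of_forall fun t => (norm_expChar j t).le)

theorem integrable_expChar (j : ℤ) : Integrable (expChar j) freqMeasure := by
  simpa using (integrable_const (μ := freqMeasure) (1 : ℂ)).expChar_mul j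

/-- The functional `g ↦ ∫ g v` is bounded on continuous functions on the circle and kills the
exponentials, whose span is uniformly dense; so it kills every test function. Hilbert space theory
does not apply, since `v` is only integrable. -/
theorem ae_eq_zero_of_integral_expChar_mul_eq_zero {v : ℝ → ℂ} (hv : Integrable v freqMeasure)
    (h : ∀ j, ∫ t, expChar j t * v t ∂freqMeasure = 0) : v =ᵐ[freqMeasure] 0 := by
  have : Fact (0 < 2 * Real.pi) := ⟨by positivity⟩
  have hcoe : Continuous fun t : ℝ => (t : AddCircle (2 * Real.pi)) := AddCircle.continuous_mk' _
  have hint : ∀ g : C(AddCircle (2 * Real.pi), ℂ),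
      Integrable (fun t : ℝ => g (t : AddCircle (2 * Real.pi)) * v t) freqMeasure := fun g =>
    hv.bdd_mul (c := ‖g‖) (g.continuous.comp hcoe).aestronglyMeasurable
      (Filter.Eventually.of_forall fun t => g.norm_coe_le_norm _)
  let Λ : C(AddCircle (2 * Real.pi), ℂ) →ₗ[ℂ] ℂ :=
    { toFun := fun g => ∫ t, g (t : AddCircle (2 * Real.pi)) * v t ∂freqMeasure
      map_add' := fun g₁ g₂ => by
        simp only [ContinuousMap.add_apply, add_mul]
        exact integral_add (hint g₁) (hint g₂)
      map_smul' := fun c g => by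
        simp only [ContinuousMap.smul_apply, smul_eq_mul, mul_assoc, RingHom.id_apply]
        exact integral_const_mul _ _ }
  let Λc := Λ.mkContinuous (∫ t, ‖v t‖ ∂freqMeasure) fun g => by
    refine (norm_integral_le_integral_norm _).trans ?_
    rw [mul_comm (∫ t, ‖v t‖ ∂freqMeasure), ← integral_const_mul]
    refine integral_mono (hint g).norm (hv.norm.const_mul _) fun t => ?_
    simp only [norm_mul]
    exact mul_le_mul_of_nonneg_right (g.norm_coe_le_norm _) (norm_nonneg _)
  have hker : ∀ g, Λc g = 0 := by
    have h1 : Submodule.span ℂ (Set.range (@fourier (2 * Real.pi))) ≤ LinearMap.ker Λc.toLinearMap := by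
      rw [Submodule.span_le]
      rintro _ ⟨j, rfl⟩
      change ∫ t, fourier j (t : AddCircle (2 * Real.pi)) * v t ∂freqMeasure = 0
      simpa only [fourier_coe_eq_expChar] using h j
    have h2 := Submodule.topologicalClosure_minimal _ h1 Λc.isClosed_ker
    rw [span_fourier_closure_eq_top] at h2
    exact fun g => h2 Submodule.mem_top
  -- A test function supported in the open interval vanishes at both endpoints, so it descends to a
  -- continuous function on the circle. The endpoint `π` is a null set.
  have hIoo : ∀ᵐ t, t ∈ Set.Ioo (-Real.pi) Real.pi → v t = 0 := by
    refine isOpen_Ioo.ae_eq_zero_of_integral_contDiff_smul_eq_zero ?_ ?_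
    · exact (IntegrableOn.mono_set hv Set.Ioo_subset_Ioc_self).locallyIntegrableOn
    · intro g hg _ hsupp
      have hout : ∀ t, t ∉ Set.Ioo (-Real.pi) Real.pi → g t = 0 := fun t ht =>
        image_eq_zero_of_notMem_tsupport fun h => ht (hsupp h)
      let φ : C(AddCircle (2 * Real.pi), ℂ) :=
        ⟨AddCircle.liftIoc (2 * Real.pi) (-Real.pi) fun t => (g t : ℂ),
          AddCircle.liftIoc_continuous (by
            rw [show -Real.pi + 2 * Real.pi = Real.pi by ring]; simp [hout]) (by
            have := hg.continuous
            exact Continuous.continuousOn (by fun_prop))⟩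
      have h3 := hker φ
      have h4 : ∫ t, φ (t : AddCircle (2 * Real.pi)) * v t ∂freqMeasure = 0 := h3
      have h5 : ∫ t in Set.Ioc (-Real.pi) Real.pi, g t • v t = 0 := by
        rw [← h4]
        refine setIntegral_congr_fun measurableSet_Ioc fun t ht => ?_
        have : t ∈ Set.Ioc (-Real.pi) (-Real.pi + 2 * Real.pi) := by
          convert ht using 2; ring
        simp [φ, AddCircle.liftIoc_coe_apply this]
      rw [← h5]
      symm
      apply setIntegral_eq_integral_of_forall_compl_eq_zero
      intro t ht
      rw [hout t fun h => ht (Set.Ioo_subset_Ioc_self h), zero_smul]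
  rw [freqMeasure, ← restrict_Ioo_eq_restrict_Ioc]
  exact (ae_restrict_iff' measurableSet_Ioo).mpr hIoo

/-- Subtracting the polynomial built from the coefficients of `v` on `S` leaves a function with no
nonzero Fourier coefficient. -/
theorem exists_trigPoly_of_integral_expChar_mul_eq_zero {v : ℝ → ℂ} (hv : Integrable v freqMeasure)
    (S : Finset ℤ) (h : ∀ j ∉ S, ∫ t, expChar (-j) t * v t ∂freqMeasure = 0) :
    ∃ q : ℤ → ℂ, v =ᵐ[freqMeasure] fun t => ∑ j ∈ S, expChar j t * q j := by
  have hpi : (Real.pi : ℂ) ≠ 0 := by exact_mod_cast Real.pi_ne_zero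
  let q : ℤ → ℂ := fun j => (2 * (Real.pi : ℂ))⁻¹ * ∫ t, expChar (-j) t * v t ∂freqMeasure
  refine ⟨q, ?_⟩
  have hint : Integrable (fun t => ∑ j ∈ S, expChar j t * q j) freqMeasure :=
    integrable_finsetSum _ fun j _ => (integrable_expChar j).mul_const _
  have := ae_eq_zero_of_integral_expChar_mul_eq_zero (hv.sub hint) fun j => by
    simp only [Pi.sub_apply, mul_sub]
    rw [integral_sub (hv.expChar_mul j) (hint.expChar_mul j), sub_eq_zero]
    simp only [Finset.mul_sum, ← mul_assoc, ← expChar_add]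
    rw [integral_finsetSum _ fun i _ => (integrable_expChar _).mul_const _]
    simp only [integral_mul_const, integral_expChar]
    -- Integration against `e^{ijt}` reads off the coefficient of frequency `-j`.
    by_cases hj : -j ∈ S
    · rw [Finset.sum_eq_single (-j)]
      · simp [q]; field_simp
      · intro i _ hi
        rw [if_neg (by omega), zero_mul]
      · exact fun h => absurd hj h
    · rw [Finset.sum_eq_zero]
      · simpa using h _ hj
      · intro i hi
        rw [if_neg (by rintro h; exact hj (by rwa [show -j = i by omega])), zero_mul]
  filter_upwards [this] with t ht
  exact sub_eq_zero.mp ht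

/-! ### Measurable square roots and the isometry into `L²`. -/

/-- `R` is a measurable Hermitian square root of `f`. -/
structure IsMeasurableSqrt (f R : ℝ → Matrix (Fin T) (Fin T) ℂ) : Prop where
  aemeasurable : ∀ i j, AEMeasurable (fun t => R t i j) freqMeasure
  isHermitian : ∀ᵐ t ∂freqMeasure, (R t).IsHermitian
  mul_self : ∀ᵐ t ∂freqMeasure, R t * R t = f t

open scoped MatrixOrder Matrix.Norms.L2Operator in
theorem continuousOn_matrix_sqrt :
    ContinuousOn (CFC.sqrt : Matrix (Fin T) (Fin T) ℂ → Matrix (Fin T) (Fin T) ℂ)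
      {M | M.PosSemidef} := by
  simpa only [Matrix.nonneg_iff_posSemidef] using
    CFC.continuousOn_sqrt (A := Matrix (Fin T) (Fin T) ℂ)

theorem isClosed_setOf_posSemidef : IsClosed {M : Fin T → Fin T → ℂ | (Matrix.of M).PosSemidef} := by
  simp only [Matrix.posSemidef_iff_dotProduct_mulVec, Matrix.IsHermitian, Set.ofPred_and,
    Set.ofPred_forall]
  refine IsClosed.inter (isClosed_eq ?_ ?_) (isClosed_iInter fun x => isClosed_le ?_ ?_)
  · exact Continuous.matrix_conjTranspose (by exact continuous_id)
  · exact continuous_id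
  · exact continuous_const
  · exact continuous_const.dotProduct (Continuous.matrix_mulVec (by exact continuous_id) continuous_const)

open scoped MatrixOrder in
theorem IsSpectralDensity.exists_isMeasurableSqrt {f : ℝ → Matrix (Fin T) (Fin T) ℂ}
    (hf : IsSpectralDensity f) : ∃ R, IsMeasurableSqrt f R := by
  classical
  refine ⟨fun t => CFC.sqrt (f t), fun i j => ?_, ?_, ?_⟩
  · let P : Set (Fin T → Fin T → ℂ) := {M | (Matrix.of M).PosSemidef}
    have hP : MeasurableSet P := isClosed_setOf_posSemidef.measurableSet
    -- The root is continuous only on the positive semidefinite cone, which is closed, and `f t`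
    -- lies there only almost everywhere; the value `0` elsewhere makes `g` measurable.
    let g : (Fin T → Fin T → ℂ) → ℂ := P.piecewise (fun M => CFC.sqrt (Matrix.of M) i j) 0
    have hg : Measurable g := by
      refine ContinuousOn.measurable_piecewise ?_ continuousOn_const hP
      exact ((continuous_apply_apply i j).comp_continuousOn
        (continuousOn_matrix_sqrt (T := T)) :)
    have hfm : AEMeasurable (fun t => fun i j => f t i j) freqMeasure :=
      aemeasurable_pi_lambda _ fun i => aemeasurable_pi_lambda _ fun j =>
        (hf.integrable i j).aestronglyMeasurable.aemeasurable
    refine (hg.comp_aemeasurable hfm).congr ?_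
    filter_upwards [hf.posSemidef] with t ht
    exact Set.piecewise_eq_of_mem P (fun M => CFC.sqrt (Matrix.of M) i j) 0 (show (f t) ∈ P from ht)
  · exact Filter.Eventually.of_forall fun t =>
      (Matrix.nonneg_iff_posSemidef.mp (CFC.sqrt_nonneg (f t))).isHermitian
  · filter_upwards [hf.posSemidef] with t ht
    exact CFC.sqrt_mul_sqrt_self (f t) (Matrix.nonneg_iff_posSemidef.mpr ht)

/-- The vector function `bᵀ R`, with values in Euclidean space. -/
noncomputable def weighted (R : ℝ → Matrix (Fin T) (Fin T) ℂ) (b : ℝ → Fin T → ℂ) (t : ℝ) :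
    EuclideanSpace ℂ (Fin T) :=
  WithLp.toLp 2 (Matrix.vecMul (b t) (R t))

section weighted

variable {f R : ℝ → Matrix (Fin T) (Fin T) ℂ}

theorem weighted_add (b c : ℝ → Fin T → ℂ) :
    weighted R (b + c) = weighted R b + weighted R c := by
  ext t; simp [weighted, Matrix.add_vecMul]

theorem weighted_sub (b c : ℝ → Fin T → ℂ) :
    weighted R (b - c) = weighted R b - weighted R c := by
  ext t; simp [weighted, Matrix.sub_vecMul]

theorem weighted_smul (a : ℂ) (b : ℝ → Fin T → ℂ) :
    weighted R (a • b) = a • weighted R b := by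
  ext t; simp [weighted, Matrix.smul_vecMul]

theorem norm_weighted_sq {b : ℝ → Fin T → ℂ} {t : ℝ} (hR : (R t).IsHermitian)
    (hm : R t * R t = f t) :
    ‖weighted R b t‖ ^ 2 = (b t ⬝ᵥ Matrix.mulVec (f t) (star (b t))).re := by
  rw [← inner_self_eq_norm_sq (𝕜 := ℂ), EuclideanSpace.inner_eq_star_dotProduct, weighted,
    Matrix.star_vecMul, hR.eq, ← Matrix.dotProduct_mulVec, Matrix.mulVec_mulVec, hm]
  rfl

theorem inner_weighted {b : ℝ → Fin T → ℂ} {t : ℝ} (hR : (R t).IsHermitian)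
    (z : EuclideanSpace ℂ (Fin T)) :
    inner ℂ (weighted R b t) z = Matrix.vecMul z.ofLp (R t) ⬝ᵥ star (b t) := by
  rw [EuclideanSpace.inner_eq_star_dotProduct, weighted, Matrix.star_vecMul, hR.eq,
    Matrix.dotProduct_mulVec]

theorem IsMeasurableSqrt.sqNorm_eq (hR : IsMeasurableSqrt f R) (b : ℝ → Fin T → ℂ) :
    sqNorm f b = eLpNorm (weighted R b) 2 freqMeasure ^ 2 := by
  have := eLpNorm_nnreal_pow_eq_lintegral (f := weighted R b) (μ := freqMeasure) (p := 2)
    two_ne_zero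
  simp only [NNReal.coe_ofNat, ENNReal.coe_ofNat, ENNReal.rpow_ofNat] at this
  rw [this, sqNorm]
  refine lintegral_congr_ae ?_
  filter_upwards [hR.isHermitian, hR.mul_self] with t h1 h2
  rw [← norm_weighted_sq h1 h2, ENNReal.ofReal_pow (norm_nonneg _), ofReal_norm]

theorem IsMeasurableSqrt.aestronglyMeasurable_weighted (hR : IsMeasurableSqrt f R)
    {b : ℝ → Fin T → ℂ} (hb : AEMeasurable b freqMeasure) :
    AEStronglyMeasurable (weighted R b) freqMeasure := by
  refine AEMeasurable.aestronglyMeasurable ?_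
  refine (WithLp.measurable_toLp 2 _).comp_aemeasurable (aemeasurable_pi_lambda _ fun j => ?_)
  simp only [Matrix.vecMul, dotProduct]
  exact Finset.aemeasurable_fun_sum _ fun i _ =>
    ((measurable_pi_apply i).comp_aemeasurable hb).mul (hR.aemeasurable i j)

theorem IsMeasurableSqrt.memLp_weighted (hR : IsMeasurableSqrt f R) {b : ℝ → Fin T → ℂ}
    (hb : b ∈ spaceL2 f) : MemLp (weighted R b) 2 freqMeasure := by
  refine ⟨hR.aestronglyMeasurable_weighted hb.1, ?_⟩
  have := hb.2
  rw [hR.sqNorm_eq] at this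
  contrapose! this
  simp [top_le_iff.mp this]

theorem IsMeasurableSqrt.mem_spaceL2_iff (hR : IsMeasurableSqrt f R) {b : ℝ → Fin T → ℂ}
    (hb : AEMeasurable b freqMeasure) :
    b ∈ spaceL2 f ↔ MemLp (weighted R b) 2 freqMeasure := by
  refine ⟨hR.memLp_weighted, fun h => ⟨hb, ?_⟩⟩
  rw [hR.sqNorm_eq]
  exact ENNReal.pow_lt_top h.2

theorem IsMeasurableSqrt.sub_mem_spaceL2 (hR : IsMeasurableSqrt f R) {b c : ℝ → Fin T → ℂ}
    (hb : b ∈ spaceL2 f) (hc : c ∈ spaceL2 f) : b - c ∈ spaceL2 f := by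
  rw [hR.mem_spaceL2_iff (hb.1.sub hc.1), weighted_sub]
  exact (hR.memLp_weighted hb).sub (hR.memLp_weighted hc)

theorem IsMeasurableSqrt.sqNorm_eq_norm_toLp (hR : IsMeasurableSqrt f R) {b : ℝ → Fin T → ℂ}
    (hb : b ∈ spaceL2 f) :
    sqNorm f b = ENNReal.ofReal (‖(hR.memLp_weighted hb).toLp‖ ^ 2) := by
  rw [hR.sqNorm_eq, Lp.norm_toLp, ENNReal.ofReal_pow ENNReal.toReal_nonneg,
    ENNReal.ofReal_toReal (hR.memLp_weighted hb).2.ne]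

/-- A square root of a spectral density has square integrable entries. -/
theorem IsMeasurableSqrt.memLp_apply (hR : IsMeasurableSqrt f R) (hf : IsSpectralDensity f)
    (i j : Fin T) : MemLp (fun t => R t i j) 2 freqMeasure := by
  rw [memLp_two_iff_integrable_sq_norm (hR.aemeasurable i j).aestronglyMeasurable]
  -- Since `R` is Hermitian, `f_jj = ∑_k |R_kj|²`, which dominates `|R_ij|²`.
  refine (hf.integrable j j).norm.mono
    ((hR.aemeasurable i j).norm.pow_const 2).aestronglyMeasurable ?_
  filter_upwards [hR.isHermitian, hR.mul_self] with t h1 h2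
  have h3 : f t j j = ((∑ k, ‖R t k j‖ ^ 2 : ℝ) : ℂ) := by
    rw [← h2, Matrix.mul_apply]
    push_cast
    refine Finset.sum_congr rfl fun k _ => ?_
    rw [← h1.apply j k, Complex.star_def, Complex.conj_mul']
  rw [norm_norm, h3, Complex.norm_real, Real.norm_of_nonneg (sq_nonneg _),
    Real.norm_of_nonneg (Finset.sum_nonneg fun _ _ => sq_nonneg _)]
  exact Finset.single_le_sum (f := fun k => ‖R t k j‖ ^ 2) (fun _ _ => sq_nonneg _)
    (Finset.mem_univ i)

/-- Each component is a sum of products of two `L²` functions. This integrability is what lets the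
`L¹` uniqueness result be applied to `zᵀR`. -/
theorem IsMeasurableSqrt.integrable_vecMul (hR : IsMeasurableSqrt f R) (hf : IsSpectralDensity f)
    {z : ℝ → EuclideanSpace ℂ (Fin T)} (hz : MemLp z 2 freqMeasure) (j : Fin T) :
    Integrable (fun t => Matrix.vecMul (z t).ofLp (R t) j) freqMeasure := by
  simp only [Matrix.vecMul, dotProduct]
  refine integrable_finsetSum _ fun i _ => ?_
  refine MemLp.integrable_mul (p := 2) (q := 2) ?_ (hR.memLp_apply hf i j)
  refine hz.mono ?_ (Filter.Eventually.of_forall fun t => PiLp.norm_apply_le _ _)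
  exact (EuclideanSpace.proj (𝕜 := ℂ) i).continuous.comp_aestronglyMeasurable hz.1

end weighted

/-! ### The observed subspace as a closed span in a Hilbert space. -/

theorem mem_spaceL2_of_continuous {f : ℝ → Matrix (Fin T) (Fin T) ℂ} (hf : IsSpectralDensity f)
    {b : ℝ → Fin T → ℂ} (hb : Continuous b) : b ∈ spaceL2 f := by
  refine ⟨hb.aemeasurable, ?_⟩
  obtain ⟨C, hC⟩ := isCompact_Icc (a := -Real.pi) (b := Real.pi) |>.exists_bound_of_continuousOn
    hb.continuousOn
  have hint : Integrable (fun t => b t ⬝ᵥ Matrix.mulVec (f t) (star (b t))) freqMeasure := by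
    have hbd : ∀ᵐ t ∂freqMeasure, ∀ i, ‖b t i‖ ≤ C := by
      filter_upwards [ae_restrict_mem measurableSet_Ioc] with t ht i
      exact (norm_le_pi_norm _ i).trans (hC t (Set.Ioc_subset_Icc_self ht))
    simp only [Matrix.mulVec, dotProduct]
    refine integrable_finsetSum _ fun i _ => Integrable.bdd_mul (c := C)
      (integrable_finsetSum _ fun j _ => Integrable.mul_bdd (c := C) (hf.integrable i j) ?_ ?_)
      (by fun_prop) (hbd.mono fun t h => h i)
    · exact ((continuous_apply j).comp hb.star).aestronglyMeasurable
    · filter_upwards [hbd] with t h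
      simpa using h j
  exact hint.re.lintegral_lt_top

theorem continuous_of_mem_observedSpan {S : Finset ℤ} {p : ℝ → Fin T → ℂ}
    (hp : p ∈ observedSpan T S) : Continuous p := by
  induction hp using Submodule.span_induction with
  | mem b hb =>
    obtain ⟨j, -, ν, rfl⟩ := hb
    exact (continuous_single ν).comp (continuous_expChar j)
  | zero => exact continuous_zero
  | add b c _ _ hb hc => exact hb.add hc
  | smul a b _ hb => exact hb.const_smul a

theorem mem_spaceL2_of_mem_observedSpan {f : ℝ → Matrix (Fin T) (Fin T) ℂ}
    (hf : IsSpectralDensity f) {S : Finset ℤ} {p : ℝ → Fin T → ℂ}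
    (hp : p ∈ observedSpan T S) : p ∈ spaceL2 f :=
  mem_spaceL2_of_continuous hf (continuous_of_mem_observedSpan hp)

/-- The image of `observedSpan` in the Hilbert space `L²` under the isometry `b ↦ bᵀ R`. -/
noncomputable def weightedSpan (S : Finset ℤ) (R : ℝ → Matrix (Fin T) (Fin T) ℂ) :
    Submodule ℂ (Lp (EuclideanSpace ℂ (Fin T)) 2 freqMeasure) :=
  Submodule.span ℂ {u | ∃ j : ℤ, j ∉ S ∧ ∃ ν : Fin T,
    u =ᵐ[freqMeasure] weighted R fun t => Pi.single ν (expChar j t)}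

section

variable {f R : ℝ → Matrix (Fin T) (Fin T) ℂ} {S : Finset ℤ}

theorem exists_mem_observedSpan_of_mem_weightedSpan
    {u : Lp (EuclideanSpace ℂ (Fin T)) 2 freqMeasure} (hu : u ∈ weightedSpan S R) :
    ∃ p ∈ observedSpan T S, u =ᵐ[freqMeasure] weighted R p := by
  induction hu using Submodule.span_induction with
  | mem u hu =>
    obtain ⟨j, hj, ν, hu⟩ := hu
    exact ⟨_, Submodule.subset_span ⟨j, hj, ν, rfl⟩, hu⟩
  | zero =>
    refine ⟨0, Submodule.zero_mem _, (Lp.coeFn_zero _ _ _).trans ?_⟩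
    exact Filter.Eventually.of_forall fun t => by simp [weighted]
  | add u v _ _ hu hv =>
    obtain ⟨p, hp, hup⟩ := hu
    obtain ⟨q, hq, hvq⟩ := hv
    refine ⟨p + q, add_mem hp hq, ?_⟩
    rw [weighted_add]
    exact (Lp.coeFn_add u v).trans (hup.add hvq)
  | smul a u _ hu =>
    obtain ⟨p, hp, hup⟩ := hu
    refine ⟨a • p, Submodule.smul_mem _ a hp, ?_⟩
    rw [weighted_smul]
    exact (Lp.coeFn_smul a u).trans (hup.const_smul a)

theorem IsMeasurableSqrt.mem_weightedSpan (hR : IsMeasurableSqrt f R) (hf : IsSpectralDensity f)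
    {p : ℝ → Fin T → ℂ} (hp : p ∈ observedSpan T S)
    {u : Lp (EuclideanSpace ℂ (Fin T)) 2 freqMeasure} (hu : u =ᵐ[freqMeasure] weighted R p) :
    u ∈ weightedSpan S R := by
  induction hp using Submodule.span_induction generalizing u with
  | mem b hb =>
    obtain ⟨j, hj, ν, rfl⟩ := hb
    exact Submodule.subset_span ⟨j, hj, ν, hu⟩
  | zero =>
    convert Submodule.zero_mem _
    refine Lp.ext (hu.trans (Filter.EventuallyEq.trans ?_ (Lp.coeFn_zero _ _ _).symm))
    exact Filter.Eventually.of_forall fun t => by simp [weighted]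
  | add b c hb hc ihb ihc =>
    have mb := hR.memLp_weighted (mem_spaceL2_of_mem_observedSpan hf hb)
    have mc := hR.memLp_weighted (mem_spaceL2_of_mem_observedSpan hf hc)
    have : u = mb.toLp + mc.toLp := by
      rw [← MemLp.toLp_add]
      refine Lp.ext (hu.trans ?_)
      rw [weighted_add]
      exact (MemLp.coeFn_toLp _).symm
    rw [this]
    exact add_mem (ihb mb.coeFn_toLp) (ihc mc.coeFn_toLp)
  | smul a b hb ihb =>
    have mb := hR.memLp_weighted (mem_spaceL2_of_mem_observedSpan hf hb)
    have : u = a • mb.toLp := by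
      rw [← MemLp.toLp_const_smul]
      refine Lp.ext (hu.trans ?_)
      rw [weighted_smul]
      exact (MemLp.coeFn_toLp _).symm
    rw [this]
    exact Submodule.smul_mem _ a (ihb mb.coeFn_toLp)

/-- Makes double orthogonal complements available. As `sqNorm` is a squared distance, the tolerances
on the two sides differ by a square. -/
theorem IsMeasurableSqrt.mem_observedL2_iff (hR : IsMeasurableSqrt f R) (hf : IsSpectralDensity f)
    {h : ℝ → Fin T → ℂ} (hh : h ∈ spaceL2 f) :
    h ∈ observedL2 S f ↔
      (hR.memLp_weighted hh).toLp ∈ (weightedSpan S R).topologicalClosure := by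
  rw [← SetLike.mem_coe, Submodule.topologicalClosure_coe, EMetric.mem_closure_iff]
  constructor
  · rintro ⟨-, happ⟩ ε hε
    obtain ⟨p, hp, hlt⟩ := happ (ε ^ 2) (ENNReal.pow_pos hε 2)
    have mp := hR.memLp_weighted (mem_spaceL2_of_mem_observedSpan hf hp)
    refine ⟨mp.toLp, hR.mem_weightedSpan hf hp mp.coeFn_toLp, ?_⟩
    rw [Lp.edist_toLp_toLp, ← weighted_sub]
    rw [hR.sqNorm_eq] at hlt
    exact lt_of_not_ge fun hge => hlt.not_ge (by gcongr)
  · refine fun happ => ⟨hh, fun ε hε => ?_⟩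
    obtain ⟨u, hu, hlt⟩ := happ (ε ^ (2⁻¹ : ℝ)) (ENNReal.rpow_pos_of_nonneg hε (by norm_num))
    obtain ⟨p, hp, hup⟩ := exists_mem_observedSpan_of_mem_weightedSpan hu
    have mp := hR.memLp_weighted (mem_spaceL2_of_mem_observedSpan hf hp)
    have : u = mp.toLp := Lp.ext (hup.trans mp.coeFn_toLp.symm)
    rw [this, Lp.edist_toLp_toLp, ← weighted_sub] at hlt
    refine ⟨p, hp, ?_⟩
    rw [hR.sqNorm_eq]
    calc _ < (ε ^ (2⁻¹ : ℝ)) ^ 2 := by gcongr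
      _ = ε := by rw [← ENNReal.rpow_natCast, ← ENNReal.rpow_mul]; norm_num

theorem IsMeasurableSqrt.inner_eq (hR : IsMeasurableSqrt f R) {b : ℝ → Fin T → ℂ}
    {u z : Lp (EuclideanSpace ℂ (Fin T)) 2 freqMeasure} (hu : u =ᵐ[freqMeasure] weighted R b) :
    inner ℂ u z = ∫ t, Matrix.vecMul (z t).ofLp (R t) ⬝ᵥ star (b t) ∂freqMeasure := by
  rw [L2.inner_def]
  refine integral_congr_ae ?_
  filter_upwards [hu, hR.isHermitian] with t h1 h2
  rw [h1, inner_weighted h2]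

theorem IsMeasurableSqrt.mem_weightedSpan_orthogonal_iff (hR : IsMeasurableSqrt f R)
    (hf : IsSpectralDensity f) {z : Lp (EuclideanSpace ℂ (Fin T)) 2 freqMeasure} :
    z ∈ (weightedSpan S R)ᗮ ↔ ∀ j ∉ S, ∀ ν,
      ∫ t, expChar (-j) t * Matrix.vecMul (z t).ofLp (R t) ν ∂freqMeasure = 0 := by
  have hgen : ∀ (u : Lp (EuclideanSpace ℂ (Fin T)) 2 freqMeasure) (j : ℤ) (ν : Fin T),
      (u =ᵐ[freqMeasure] weighted R fun t => Pi.single ν (expChar j t)) →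
      inner ℂ u z =
        ∫ t, expChar (-j) t * Matrix.vecMul (z t).ofLp (R t) ν ∂freqMeasure := by
    intro u j ν hu
    rw [hR.inner_eq hu]
    congr 1 with t
    rw [← Pi.single_star, dotProduct_single, star_expChar, mul_comm]
  constructor
  · intro hz j hj ν
    have hp : (fun t => Pi.single ν (expChar j t)) ∈ observedSpan T S :=
      Submodule.subset_span ⟨j, hj, ν, rfl⟩
    have mp := hR.memLp_weighted (mem_spaceL2_of_mem_observedSpan hf hp)
    rw [← hgen _ j ν mp.coeFn_toLp]
    exact hz _ (hR.mem_weightedSpan hf hp mp.coeFn_toLp)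
  · intro hz u hu
    -- Orthogonality to `z` is a linear condition, so it need only be checked on generators.
    have : weightedSpan S R ≤ (ℂ ∙ z)ᗮ := by
      refine Submodule.span_le.mpr ?_
      rintro u ⟨j, hj, ν, hu⟩
      rw [SetLike.mem_coe, Submodule.mem_orthogonal_singleton_iff_inner_left, hgen u j ν hu]
      exact hz j hj ν
    exact Submodule.mem_orthogonal_singleton_iff_inner_left.mp (this hu)

end

/-- An integrable element of `L₂(f)` whose Fourier coefficients vanish on `S` belongs to the closed
subspace generated by the exponentials with frequencies outside `S`. -/
theorem mem_observedL2_of_integral_expChar_mul_eq_zero {f : ℝ → Matrix (Fin T) (Fin T) ℂ}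
    (hf : IsSpectralDensity f) {S : Finset ℤ} {h : ℝ → Fin T → ℂ} (hh : h ∈ spaceL2 f)
    (hint : ∀ ν, Integrable (fun t => h t ν) freqMeasure)
    (hcoeff : ∀ j ∈ S, ∀ ν, ∫ t, expChar (-j) t * h t ν ∂freqMeasure = 0) :
    h ∈ observedL2 S f := by
  obtain ⟨R, hR⟩ := hf.exists_isMeasurableSqrt
  -- The closure is the double orthogonal complement, so it suffices to test `h` against each `z`
  -- orthogonal to the span.
  rw [hR.mem_observedL2_iff hf hh, ← Submodule.orthogonal_orthogonal_eq_closure]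
  intro z hz
  rw [hR.mem_weightedSpan_orthogonal_iff hf] at hz
  rw [← inner_conj_symm, map_eq_zero, hR.inner_eq (hR.memLp_weighted hh).coeFn_toLp]
  have hv := fun ν => exists_trigPoly_of_integral_expChar_mul_eq_zero
    (hR.integrable_vecMul hf (Lp.memLp z) ν) S fun j hj => hz j hj ν
  choose q hq using hv
  -- Since `zᵀR` is a polynomial with frequencies in `S`, the pairing is a finite combination of
  -- conjugated Fourier coefficients of `h` on `S`, all of which vanish.
  have : (fun t => Matrix.vecMul (z t).ofLp (R t) ⬝ᵥ star (h t)) =ᵐ[freqMeasure]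
      fun t => ∑ ν, ∑ j ∈ S, q ν j * star (expChar (-j) t * h t ν) := by
    filter_upwards [ae_all_iff.mpr hq] with t ht
    simp only [dotProduct, ht, Finset.sum_mul, star_mul', star_expChar, neg_neg, Pi.star_apply]
    refine Finset.sum_congr rfl fun ν _ => Finset.sum_congr rfl fun j _ => by ring
  have hi : ∀ ν j, Integrable (fun t => q ν j * star (expChar (-j) t * h t ν)) freqMeasure :=
    fun ν j =>
    (Complex.conjCLE.toContinuousLinearMap.integrable_comp ((hint ν).expChar_mul (-j))).const_mul _
  rw [integral_congr_ae this, integral_finsetSum _ fun ν _ => integrable_finsetSum _ fun j _ => hi ν j]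
  refine Finset.sum_eq_zero fun ν _ => ?_
  rw [integral_finsetSum _ fun j _ => hi ν j]
  refine Finset.sum_eq_zero fun j hj => ?_
  rw [integral_const_mul]
  have := integral_conj (f := fun t => expChar (-j) t * h t ν) (μ := freqMeasure)
  rw [hcoeff j hj ν] at this
  simp only [Complex.star_def]
  rw [this]; simp

/-! ### Trace bound for matrix entries, and vector trigonometric polynomials. -/

-- Writing `M = N* N`, an entry is an inner product of two columns of `N` and the trace is the sum
-- of all squared column norms. This turns integrability of `Tr f⁻¹` into integrability of every
-- entry of `f⁻¹`.
open scoped MatrixOrder Matrix.Norms.L2Operator in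
theorem Matrix.PosSemidef.norm_apply_le_norm_trace {M : Matrix (Fin T) (Fin T) ℂ}
    (hM : M.PosSemidef) (i j : Fin T) : ‖M i j‖ ≤ ‖M.trace‖ := by
  obtain ⟨N, rfl⟩ := CStarAlgebra.nonneg_iff_eq_star_mul_self.mp hM.nonneg
  rw [Matrix.star_eq_conjTranspose]
  have htr : (N.conjTranspose * N).trace = ((∑ l, ∑ k, ‖N k l‖ ^ 2 : ℝ) : ℂ) := by
    simp [Matrix.trace, Matrix.mul_apply, Complex.conj_mul']
  have hle : ∀ l, ∑ k, ‖N k l‖ ^ 2 ≤ ∑ l, ∑ k, ‖N k l‖ ^ 2 := fun l =>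
    Finset.single_le_sum (f := fun l => ∑ k, ‖N k l‖ ^ 2)
      (fun _ _ => Finset.sum_nonneg fun _ _ => sq_nonneg _) (Finset.mem_univ l)
  rw [htr, Complex.norm_real, Real.norm_of_nonneg
    (Finset.sum_nonneg fun _ _ => Finset.sum_nonneg fun _ _ => sq_nonneg _), Matrix.mul_apply]
  calc ‖∑ k, N.conjTranspose i k * N k j‖ ≤ ∑ k, (‖N k i‖ ^ 2 + ‖N k j‖ ^ 2) / 2 := by
        refine norm_sum_le_of_le _ fun k _ => ?_
        rw [norm_mul, Matrix.conjTranspose_apply, norm_star]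
        nlinarith [sq_nonneg (‖N k i‖ - ‖N k j‖)]
    _ = (∑ k, ‖N k i‖ ^ 2 + ∑ k, ‖N k j‖ ^ 2) / 2 := by
        rw [← Finset.sum_div, Finset.sum_add_distrib]
    _ ≤ _ := by linarith [hle i, hle j]

theorem continuous_trigPoly (S : Finset ℤ) (c : ℤ → Fin T → ℂ) : Continuous (trigPoly S c) :=
  continuous_finsetSum _ fun j _ => (continuous_expChar j).smul continuous_const

theorem trigPoly_apply (S : Finset ℤ) (c : ℤ → Fin T → ℂ) (t : ℝ) (ν : Fin T) :
    trigPoly S c t ν = ∑ j ∈ S, expChar j t * c j ν := by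
  simp [trigPoly]

theorem integrable_trigPoly_apply (S : Finset ℤ) (c : ℤ → Fin T → ℂ) (ν : Fin T) :
    Integrable (fun t => trigPoly S c t ν) freqMeasure := by
  simp only [trigPoly_apply]
  exact integrable_finsetSum _ fun j _ => (integrable_expChar j).mul_const _

theorem integral_expChar_mul_trigPoly (S : Finset ℤ) (c : ℤ → Fin T → ℂ) (k : ℤ) (ν : Fin T) :
    ∫ t, expChar (-k) t * trigPoly S c t ν ∂freqMeasure =
      if k ∈ S then 2 * (Real.pi : ℂ) * c k ν else 0 := by
  simp only [trigPoly_apply, Finset.mul_sum, ← mul_assoc, ← expChar_add]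
  rw [integral_finsetSum _ fun i _ => (integrable_expChar _).mul_const _]
  simp only [integral_mul_const, integral_expChar]
  split_ifs with hk
  · rw [Finset.sum_eq_single k]
    · simp
    · intro i _ hi
      rw [if_neg (by omega), zero_mul]
    · exact fun h => absurd hk h
  · refine Finset.sum_eq_zero fun i hi => ?_
    rw [if_neg (by rintro h; exact hk (by rwa [show k = i by omega])), zero_mul]

theorem norm_trigPoly_apply_le (S : Finset ℤ) (c : ℤ → Fin T → ℂ) (t : ℝ) (ν : Fin T) :
    ‖trigPoly S c t ν‖ ≤ ∑ j ∈ S, ‖c j ν‖ := by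
  rw [trigPoly_apply]
  exact norm_sum_le_of_le _ fun j _ => by rw [norm_mul, norm_expChar, one_mul]

/-! ### Integrability of the inverse density and invertibility of `B`. -/

section minimality

variable {f : ℝ → Matrix (Fin T) (Fin T) ℂ}

theorem IsSpectralDensity.aemeasurable_inv_apply (hf : IsSpectralDensity f) (i j : Fin T) :
    AEMeasurable (fun t => (f t)⁻¹ i j) freqMeasure := by
  have hfm : AEMeasurable (fun t => fun i j => f t i j) freqMeasure :=
    aemeasurable_pi_lambda _ fun i => aemeasurable_pi_lambda _ fun j =>
      (hf.integrable i j).aestronglyMeasurable.aemeasurable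
  have hdet : Continuous fun M : Fin T → Fin T → ℂ => (Matrix.of M).det :=
    Continuous.matrix_det (by exact continuous_id)
  have hadj : Continuous fun M : Fin T → Fin T → ℂ => (Matrix.of M).adjugate i j :=
    (Continuous.matrix_adjugate (by exact continuous_id)).matrix_elem i j
  have := (hdet.measurable.comp_aemeasurable hfm).inv.mul (hadj.measurable.comp_aemeasurable hfm)
  refine this.congr (Filter.Eventually.of_forall fun t => ?_)
  simp only [Matrix.inv_def, Ring.inverse_eq_inv', Matrix.smul_apply, smul_eq_mul]
  rfl

theorem MinimalityCondition.integrable_inv_apply (hmin : MinimalityCondition f)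
    (hf : IsSpectralDensity f) (i j : Fin T) :
    Integrable (fun t => (f t)⁻¹ i j) freqMeasure := by
  refine hmin.integrable_trace.mono (hf.aemeasurable_inv_apply i j).aestronglyMeasurable ?_
  filter_upwards [hf.posSemidef] with t ht
  exact ht.inv.norm_apply_le_norm_trace i j

theorem MinimalityCondition.integrable_trigPoly_vecMul_inv (hmin : MinimalityCondition f)
    (hf : IsSpectralDensity f) (S : Finset ℤ) (c : ℤ → Fin T → ℂ) (ν : Fin T) :
    Integrable (fun t => Matrix.vecMul (trigPoly S c t) (f t)⁻¹ ν) freqMeasure := by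
  simp only [Matrix.vecMul, dotProduct]
  exact integrable_finsetSum _ fun μ _ => (hmin.integrable_inv_apply hf μ ν).bdd_mul
    ((continuous_apply μ).comp (continuous_trigPoly S c)).aestronglyMeasurable
    (Filter.Eventually.of_forall fun t => norm_trigPoly_apply_le S c t μ)

/-- Identifies `B` as the operator taking the coefficients of `C` to those of `Cᵀ f⁻¹` on `S`; the
row-vector product accounts for the transpose in `B`. -/
theorem MinimalityCondition.integral_expChar_mul_vecMul_inv (hmin : MinimalityCondition f)
    (hf : IsSpectralDensity f) (S : Finset ℤ) (c : ℤ → Fin T → ℂ) (k : S) (ν : Fin T) :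
    ∫ t, expChar (-(k : ℤ)) t * Matrix.vecMul (trigPoly S c t) (f t)⁻¹ ν ∂freqMeasure =
      2 * (Real.pi : ℂ) *
        Matrix.mulVec (blockMatrix S f) (fun q : S × Fin T => c (q.1 : ℤ) q.2) (k, ν) := by
  have hpi : (Real.pi : ℂ) ≠ 0 := by exact_mod_cast Real.pi_ne_zero
  have hexp : ∀ t, expChar (-(k : ℤ)) t * Matrix.vecMul (trigPoly S c t) (f t)⁻¹ ν =
      ∑ j : S, ∑ μ, (f t)⁻¹.transpose ν μ * expChar ((j : ℤ) - k) t * c j μ := by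
    intro t
    simp only [Matrix.vecMul, dotProduct, trigPoly_apply, ← Finset.sum_coe_sort S,
      Finset.sum_mul, Finset.mul_sum]
    rw [Finset.sum_comm]
    refine Finset.sum_congr rfl fun j _ => Finset.sum_congr rfl fun μ _ => ?_
    rw [sub_eq_add_neg, expChar_add, Matrix.transpose_apply]
    ring
  have hi : ∀ (j : S) (μ : Fin T), Integrable
      (fun t => (f t)⁻¹.transpose ν μ * expChar ((j : ℤ) - k) t * c j μ) freqMeasure := by
    intro j μ
    refine Integrable.mul_const ?_ _
    simpa only [mul_comm, Matrix.transpose_apply] using (hmin.integrable_inv_apply hf μ ν).expChar_mul ((j : ℤ) - k)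
  simp only [hexp]
  rw [integral_finsetSum _ fun j _ => integrable_finsetSum _ fun μ _ => hi j μ]
  simp only [integral_finsetSum _ fun μ _ => hi _ μ, integral_mul_const, Matrix.mulVec, dotProduct,
    Fintype.sum_prod_type, blockMatrix, Finset.mul_sum]
  refine Finset.sum_congr rfl fun j _ => Finset.sum_congr rfl fun μ _ => ?_
  field_simp

/-- Extension by zero of a family of coefficients indexed by `S × Fin T`. -/
noncomputable def extendCoeff (S : Finset ℤ) (x : S × Fin T → ℂ) (j : ℤ) (ν : Fin T) : ℂ :=
  if hj : j ∈ S then x (⟨j, hj⟩, ν) else 0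

theorem extendCoeff_coe (S : Finset ℤ) (x : S × Fin T → ℂ) (q : S × Fin T) :
    extendCoeff S x (q.1 : ℤ) q.2 = x q := by
  simp [extendCoeff]

theorem MinimalityCondition.ae_posDef (hmin : MinimalityCondition f) (hf : IsSpectralDensity f) :
    ∀ᵐ t ∂freqMeasure, (f t).PosDef := by
  filter_upwards [hf.posSemidef, hmin.isUnit_det] with t h1 h2
  exact h1.posDef_iff_isUnit.mpr ((Matrix.isUnit_iff_isUnit_det _).mpr h2)

/-- If `B x = 0` and `X` is the polynomial with coefficients `x`, then `Xᵀ f⁻¹` has no coefficients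
on `S`, so `∫ Xᵀ f⁻¹ conj X = 0`. Positive definiteness of `f⁻¹` forces `X = 0` almost everywhere,
hence `x = 0`. -/
theorem MinimalityCondition.isUnit_det_blockMatrix (hmin : MinimalityCondition f)
    (hf : IsSpectralDensity f) (S : Finset ℤ) : IsUnit (blockMatrix S f).det := by
  have hpi : (Real.pi : ℂ) ≠ 0 := by exact_mod_cast Real.pi_ne_zero
  rw [← Matrix.isUnit_iff_isUnit_det, ← Matrix.mulVec_injective_iff_isUnit]
  refine (injective_iff_map_eq_zero (Matrix.mulVecLin (blockMatrix S f))).mpr fun x hx => ?_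
  set c := extendCoeff S x
  have hc : (fun q : S × Fin T => c (q.1 : ℤ) q.2) = x := funext (extendCoeff_coe S x)
  have hcoeff : ∀ j ∈ S, ∀ ν,
      ∫ t, expChar (-j) t * Matrix.vecMul (trigPoly S c t) (f t)⁻¹ ν ∂freqMeasure = 0 := by
    intro j hj ν
    rw [hmin.integral_expChar_mul_vecMul_inv hf S c ⟨j, hj⟩ ν, hc]
    have := congrFun hx (⟨j, hj⟩, ν)
    rw [Matrix.mulVecLin_apply] at this
    simp [this]
  have hexp : ∀ t, Matrix.vecMul (trigPoly S c t) (f t)⁻¹ ⬝ᵥ star (trigPoly S c t) =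
      ∑ ν, ∑ j ∈ S, star (c j ν) *
        (expChar (-j) t * Matrix.vecMul (trigPoly S c t) (f t)⁻¹ ν) := by
    intro t
    simp only [dotProduct, Pi.star_apply, trigPoly_apply, star_sum, star_mul', star_expChar,
      Finset.mul_sum]
    refine Finset.sum_congr rfl fun ν _ => Finset.sum_congr rfl fun j _ => by ring
  have hi : ∀ j ν, Integrable (fun t => star (c j ν) *
      (expChar (-j) t * Matrix.vecMul (trigPoly S c t) (f t)⁻¹ ν)) freqMeasure := fun j ν =>
    ((hmin.integrable_trigPoly_vecMul_inv hf S c ν).expChar_mul (-j)).const_mul _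
  have hint : Integrable (fun t => Matrix.vecMul (trigPoly S c t) (f t)⁻¹ ⬝ᵥ
      star (trigPoly S c t)) freqMeasure := by
    simp only [hexp]
    exact integrable_finsetSum _ fun ν _ => integrable_finsetSum _ fun j _ => hi j ν
  have hzero : ∫ t, Matrix.vecMul (trigPoly S c t) (f t)⁻¹ ⬝ᵥ star (trigPoly S c t)
      ∂freqMeasure = 0 := by
    simp only [hexp]
    rw [integral_finsetSum _ fun ν _ => integrable_finsetSum _ fun j _ => hi j ν]
    refine Finset.sum_eq_zero fun ν _ => ?_
    rw [integral_finsetSum _ fun j _ => hi j ν]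
    exact Finset.sum_eq_zero fun j hj => by rw [integral_const_mul, hcoeff j hj ν, mul_zero]
  have hre := integral_re hint
  rw [hzero, map_zero, integral_eq_zero_iff_of_nonneg_ae ?_ hint.re] at hre
  · have hX : ∀ᵐ t ∂freqMeasure, trigPoly S c t = 0 := by
      filter_upwards [hre, hmin.ae_posDef hf] with t h1 h2
      by_contra hne
      have := h2.inv.re_dotProduct_pos (x := star (trigPoly S c t)) (by simpa using hne)
      rw [star_star, Matrix.dotProduct_mulVec] at this
      exact this.ne' h1
    funext q
    have h2 := integral_expChar_mul_trigPoly S c q.1 q.2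
    rw [if_pos q.1.2, show c q.1 q.2 = x q from extendCoeff_coe S x q] at h2
    rw [integral_congr_ae (g := fun _ => (0 : ℂ)) (by
      filter_upwards [hX] with t ht
      simp [ht]), integral_zero] at h2
    simpa [hpi] using h2.symm
  · filter_upwards [hf.posSemidef] with t ht
    have := ht.inv.re_dotProduct_nonneg (star (trigPoly S c t))
    rwa [star_star, Matrix.dotProduct_mulVec] at this

end minimality

/-! ### The function `h(f₀)`: error, membership, orthogonality and uniqueness. -/

section

variable {S : Finset ℤ} {a : ℤ → Fin T → ℂ} {f₀ f : ℝ → Matrix (Fin T) (Fin T) ℂ}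

theorem trigPoly_sub_specChar :
    trigPoly S a - specChar S a f₀ = fun t => Matrix.vecMul (optPoly S a f₀ t) (f₀ t)⁻¹ := by
  ext t; simp [specChar]

theorem meanSqError_specChar (hf₀ : IsSpectralDensity f₀) :
    meanSqError S a (specChar S a f₀) f = linFunctional S a f₀ f := by
  rw [meanSqError, linFunctional, trigPoly_sub_specChar, sqNorm]
  congr 1
  refine lintegral_congr_ae ?_
  filter_upwards [hf₀.posSemidef] with t ht
  rw [Matrix.star_vecMul, ht.inv.isHermitian.eq, Matrix.mulVec_mulVec, Matrix.dotProduct_mulVec,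
    Matrix.vecMul_vecMul, ← Matrix.mul_assoc]

/-- At `f = f₀` the middle factor collapses to `f₀⁻¹`, which has integrable entries, and `C⁰` is
bounded. -/
theorem MinimalityCondition.linFunctional_self_lt_top (hmin : MinimalityCondition f₀)
    (hf₀ : IsSpectralDensity f₀) : linFunctional S a f₀ f₀ < ⊤ := by
  refine ENNReal.mul_lt_top ENNReal.ofReal_lt_top ?_
  have hint : Integrable (fun t => Matrix.vecMul (optPoly S a f₀ t) (f₀ t)⁻¹ ⬝ᵥ
      star (optPoly S a f₀ t)) freqMeasure := by
    simp only [dotProduct]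
    refine integrable_finsetSum _ fun ν _ =>
      (hmin.integrable_trigPoly_vecMul_inv hf₀ S _ ν).mul_bdd
        (c := ∑ j ∈ S, ‖optCoeff S a f₀ j ν‖) ?_ (Filter.Eventually.of_forall fun t => ?_)
    · exact ((continuous_apply ν).comp (continuous_trigPoly S _).star).aestronglyMeasurable
    · rw [Pi.star_apply, norm_star]
      exact norm_trigPoly_apply_le S _ t ν
  refine lt_of_eq_of_lt (lintegral_congr_ae ?_) hint.re.lintegral_lt_top
  filter_upwards [hmin.isUnit_det] with t ht
  rw [Matrix.nonsing_inv_mul _ ht, one_mul]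
  rfl

theorem sqNorm_lt_top_of_meanSqError_lt_top {h : ℝ → Fin T → ℂ}
    (hh : meanSqError S a h f < ⊤) : sqNorm f (trigPoly S a - h) < ⊤ :=
  ENNReal.lt_top_of_mul_ne_top_right hh.ne
    (ENNReal.ofReal_pos.mpr (by have := Real.pi_pos; positivity)).ne'

theorem IsSpectralDensity.aemeasurable_specChar (hf₀ : IsSpectralDensity f₀) :
    AEMeasurable (specChar S a f₀) freqMeasure := by
  refine (continuous_trigPoly S a).aemeasurable.sub (aemeasurable_pi_lambda _ fun ν => ?_)
  simp only [Matrix.vecMul, dotProduct]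
  exact Finset.aemeasurable_fun_sum _ fun μ _ =>
    ((continuous_apply μ).comp (continuous_trigPoly S _)).aemeasurable.mul
      (hf₀.aemeasurable_inv_apply μ ν)

/-- Up to the factor `2π`, the coefficients at `k` of `A` and of `C⁰ᵀ f₀⁻¹` are `a(k)` and `(B
c)(k)`, which agree by the choice of `c`. -/
theorem MinimalityCondition.integral_expChar_mul_specChar (hmin : MinimalityCondition f₀)
    (hf₀ : IsSpectralDensity f₀) {k : ℤ} (hk : k ∈ S) (ν : Fin T) :
    ∫ t, expChar (-k) t * specChar S a f₀ t ν ∂freqMeasure = 0 := by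
  simp only [specChar, optPoly, Pi.sub_apply, mul_sub]
  rw [integral_sub ((integrable_trigPoly_apply S a ν).expChar_mul _)
    ((hmin.integrable_trigPoly_vecMul_inv hf₀ S _ ν).expChar_mul _),
    integral_expChar_mul_trigPoly, if_pos hk]
  have h := hmin.integral_expChar_mul_vecMul_inv hf₀ S (optCoeff S a f₀) ⟨k, hk⟩ ν
  have hc : (fun q : S × Fin T => optCoeff S a f₀ (q.1 : ℤ) q.2) =
      Matrix.mulVec (blockMatrix S f₀)⁻¹ (fun p : S × Fin T => a (p.1 : ℤ) p.2) :=
    funext (extendCoeff_coe S _)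
  rw [hc, Matrix.mulVec_mulVec, Matrix.mul_nonsing_inv _ (hmin.isUnit_det_blockMatrix hf₀ S),
    Matrix.one_mulVec] at h
  exact sub_eq_zero.mpr h.symm

/-- The function `h(f₀)` has vanishing Fourier coefficients on `S`, hence belongs to
`L₂^{s-}(f)` as soon as its error is finite. -/
theorem MinimalityCondition.specChar_mem_observedL2 (hmin : MinimalityCondition f₀)
    (hf₀ : IsSpectralDensity f₀) (hf : IsSpectralDensity f)
    (hfin : linFunctional S a f₀ f < ⊤) : specChar S a f₀ ∈ observedL2 S f := by
  obtain ⟨R, hR⟩ := hf.exists_isMeasurableSqrt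
  have hA : trigPoly S a ∈ spaceL2 f := mem_spaceL2_of_continuous hf (continuous_trigPoly S a)
  have hd : trigPoly S a - specChar S a f₀ ∈ spaceL2 f :=
    ⟨hA.1.sub hf₀.aemeasurable_specChar,
      sqNorm_lt_top_of_meanSqError_lt_top (by rwa [meanSqError_specChar hf₀])⟩
  refine mem_observedL2_of_integral_expChar_mul_eq_zero hf ?_ (fun ν => ?_)
    fun j hj ν => hmin.integral_expChar_mul_specChar hf₀ hj ν
  -- `h(f₀) = A - (A - h(f₀))`, where `A` is continuous and the difference has finite error.
  · simpa using hR.sub_mem_spaceL2 hA hd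
  · exact (integrable_trigPoly_apply S a ν).sub
      (hmin.integrable_trigPoly_vecMul_inv hf₀ S _ ν)

theorem MinimalityCondition.sqNorm_trigPoly_sub (hmin : MinimalityCondition f₀)
    (hf₀ : IsSpectralDensity f₀) {h : ℝ → Fin T → ℂ} (hh : h ∈ observedL2 S f₀) :
    sqNorm f₀ (trigPoly S a - h) = sqNorm f₀ (trigPoly S a - specChar S a f₀) +
      sqNorm f₀ (specChar S a f₀ - h) := by
  obtain ⟨R, hR⟩ := hf₀.exists_isMeasurableSqrt
  have hA : trigPoly S a ∈ spaceL2 f₀ := mem_spaceL2_of_continuous hf₀ (continuous_trigPoly S a)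
  have hs := hmin.specChar_mem_observedL2 hf₀ hf₀ (hmin.linFunctional_self_lt_top (S := S) (a := a) hf₀)
  have hd := hR.sub_mem_spaceL2 hA hs.1
  have he := hR.sub_mem_spaceL2 hs.1 hh.1
  rw [hR.sqNorm_eq_norm_toLp (hR.sub_mem_spaceL2 hA hh.1), hR.sqNorm_eq_norm_toLp hd,
    hR.sqNorm_eq_norm_toLp he, ← ENNReal.ofReal_add (sq_nonneg _) (sq_nonneg _)]
  congr 1
  have hsum : (hR.memLp_weighted (hR.sub_mem_spaceL2 hA hh.1)).toLp =
      (hR.memLp_weighted hd).toLp + (hR.memLp_weighted he).toLp := by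
    rw [← MemLp.toLp_add]
    congr 1
    rw [← weighted_add, sub_add_sub_cancel]
  have hdiff : (hR.memLp_weighted he).toLp ∈ (weightedSpan S R).topologicalClosure := by
    have := sub_mem ((hR.mem_observedL2_iff hf₀ hs.1).mp hs) ((hR.mem_observedL2_iff hf₀ hh.1).mp hh)
    rw [← MemLp.toLp_sub] at this
    convert this using 2
    exact weighted_sub _ _
  -- Weighting the error by `R` twice gives `C⁰ᵀ f₀⁻¹ f₀ = C⁰ᵀ`, which has no frequency outside `S`.
  have horth : (hR.memLp_weighted hd).toLp ∈ (weightedSpan S R)ᗮ := by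
    rw [hR.mem_weightedSpan_orthogonal_iff hf₀]
    intro j hj ν
    have := integral_expChar_mul_trigPoly S (optCoeff S a f₀) j ν
    rw [if_neg hj] at this
    rw [← this]
    refine integral_congr_ae ?_
    filter_upwards [(hR.memLp_weighted hd).coeFn_toLp, hR.mul_self, hmin.isUnit_det] with t h1 h2 h3
    rw [h1, weighted, Matrix.vecMul_vecMul, h2, trigPoly_sub_specChar, Matrix.vecMul_vecMul,
      Matrix.nonsing_inv_mul _ h3, Matrix.vecMul_one]
    rfl
  rw [← Submodule.orthogonal_closure] at horth
  rw [hsum, pow_two, pow_two, pow_two]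
  exact norm_add_sq_eq_norm_sq_add_norm_sq_of_inner_eq_zero _ _
    (Submodule.inner_left_of_mem_orthogonal hdiff horth)

theorem MinimalityCondition.ae_eq_of_sqNorm_sub_eq_zero (hmin : MinimalityCondition f₀)
    (hf₀ : IsSpectralDensity f₀) {b c : ℝ → Fin T → ℂ} (hb : AEMeasurable b freqMeasure)
    (hc : AEMeasurable c freqMeasure) (h : sqNorm f₀ (b - c) = 0) : b =ᵐ[freqMeasure] c := by
  obtain ⟨R, hR⟩ := hf₀.exists_isMeasurableSqrt
  rw [hR.sqNorm_eq, sq_eq_zero_iff,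
    eLpNorm_eq_zero_iff (hR.aestronglyMeasurable_weighted (hb.sub hc)) two_ne_zero] at h
  filter_upwards [h, hR.mul_self, hmin.isUnit_det] with t h1 h2 h3
  have h4 : Matrix.vecMul ((b - c) t) (R t) = 0 := congrArg WithLp.ofLp h1
  have h5 : Matrix.vecMul ((b - c) t) (f₀ t) = 0 := by
    rw [← h2, ← Matrix.vecMul_vecMul, h4, Matrix.zero_vecMul]
  have h6 : Matrix.vecMul (Matrix.vecMul ((b - c) t) (f₀ t)) (f₀ t)⁻¹ = (b - c) t := by
    rw [Matrix.vecMul_vecMul, Matrix.mul_nonsing_inv _ h3, Matrix.vecMul_one]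
  rw [h5, Matrix.zero_vecMul] at h6
  exact sub_eq_zero.mp h6.symm

theorem MinimalityCondition.meanSqError_eq_add (hmin : MinimalityCondition f₀)
    (hf₀ : IsSpectralDensity f₀) {h : ℝ → Fin T → ℂ} (hh : h ∈ observedL2 S f₀) :
    meanSqError S a h f₀ = meanSqError S a (specChar S a f₀) f₀ +
      ENNReal.ofReal (1 / (2 * Real.pi)) * sqNorm f₀ (specChar S a f₀ - h) := by
  rw [meanSqError, hmin.sqNorm_trigPoly_sub hf₀ hh, mul_add, meanSqError]

theorem MinimalityCondition.isOptimalChar_specChar (hmin : MinimalityCondition f₀)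
    (hf₀ : IsSpectralDensity f₀) : IsOptimalChar S a f₀ (specChar S a f₀) :=
  ⟨hmin.specChar_mem_observedL2 hf₀ hf₀ (hmin.linFunctional_self_lt_top hf₀), fun h hh => by
    rw [hmin.meanSqError_eq_add hf₀ hh]; exact le_self_add⟩

theorem MinimalityCondition.ae_eq_specChar_of_meanSqError_le (hmin : MinimalityCondition f₀)
    (hf₀ : IsSpectralDensity f₀) {h : ℝ → Fin T → ℂ} (hh : h ∈ observedL2 S f₀)
    (hle : meanSqError S a h f₀ ≤ meanSqError S a (specChar S a f₀) f₀) :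
    h =ᵐ[freqMeasure] specChar S a f₀ := by
  -- Finiteness permits cancelling the optimal error in the extended reals, leaving a zero distance.
  have hfin : meanSqError S a (specChar S a f₀) f₀ ≠ ⊤ := by
    rw [meanSqError_specChar hf₀]; exact (hmin.linFunctional_self_lt_top hf₀).ne
  rw [hmin.meanSqError_eq_add hf₀ hh] at hle
  have h0 : ENNReal.ofReal (1 / (2 * Real.pi)) * sqNorm f₀ (specChar S a f₀ - h) = 0 := by
    refine le_antisymm ((ENNReal.add_le_add_iff_left hfin).mp ?_) bot_le
    simpa using hle
  refine (hmin.ae_eq_of_sqNorm_sub_eq_zero hf₀ hf₀.aemeasurable_specChar hh.1.1 ?_).symm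
  refine (mul_eq_zero.mp h0).resolve_left ?_
  exact (ENNReal.ofReal_pos.mpr (by have := Real.pi_pos; positivity)).ne'

end

end

/-! ### The saddle-point argument. -/

theorem mainTheorem9 (T s : ℕ) (N K : ℕ → ℕ) (a : ℤ → Fin T → ℂ)
    (D : Set (ℝ → Matrix (Fin T) (Fin T) ℂ))
    (hD : ∀ f ∈ D, IsSpectralDensity f)
    (f₀ : ℝ → Matrix (Fin T) (Fin T) ℂ) (hf₀ : f₀ ∈ D)
    (hmin : MinimalityCondition f₀)
    (hmax : ∀ f ∈ D, linFunctional (missedPoints s N K) a f₀ f ≤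
      linFunctional (missedPoints s N K) a f₀ f₀) :
    IsLeastFavorable (missedPoints s N K) a D f₀ ∧
    IsOptimalChar (missedPoints s N K) a f₀ (specChar (missedPoints s N K) a f₀) ∧
    (∀ f ∈ D, meanSqError (missedPoints s N K) a (specChar (missedPoints s N K) a f₀) f =
      linFunctional (missedPoints s N K) a f₀ f) ∧
    (specChar (missedPoints s N K) a f₀ ∈ admissibleChars (missedPoints s N K) D →
      IsMinimaxChar (missedPoints s N K) a D (specChar (missedPoints s N K) a f₀) ∧
      ∀ h, IsMinimaxChar (missedPoints s N K) a D h →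
        h =ᵐ[freqMeasure] specChar (missedPoints s N K) a f₀) := by
  have hd := hD f₀ hf₀
  generalize missedPoints s N K = S at *
  have hopt : IsOptimalChar S a f₀ (specChar S a f₀) := hmin.isOptimalChar_specChar hd
  have herr : ∀ f, meanSqError S a (specChar S a f₀) f = linFunctional S a f₀ f :=
    fun f => meanSqError_specChar hd
  -- Maximality at `f₀` bounds the error of `h(f₀)` for every `f ∈ D` by a finite number, so
  -- membership follows for all of `D`.
  have hmem : ∀ f ∈ D, specChar S a f₀ ∈ observedL2 S f := fun f hf =>
    hmin.specChar_mem_observedL2 hd (hD f hf)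
      ((hmax f hf).trans_lt (hmin.linFunctional_self_lt_top hd))
  have hsaddle : ∀ f ∈ D,
      meanSqError S a (specChar S a f₀) f ≤ meanSqError S a (specChar S a f₀) f₀ := fun f hf => by
    rw [herr, herr]; exact hmax f hf
  refine ⟨⟨hf₀, fun f hf => ?_⟩, hopt, fun f _ => herr f, fun hadm => ⟨⟨hadm, f₀, hf₀, hsaddle,
    fun h hh => ?_⟩, ?_⟩⟩
  · calc optimalError S a f ≤ meanSqError S a (specChar S a f₀) f := iInf₂_le _ (hmem f hf)
      _ ≤ meanSqError S a (specChar S a f₀) f₀ := hsaddle f hf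
      _ ≤ optimalError S a f₀ := le_iInf₂ hopt.2
  · exact (hopt.2 h (Set.mem_iInter₂.mp hh f₀ hf₀)).trans
      (le_iSup₂ (f := fun f _ => meanSqError S a h f) f₀ hf₀)
  · rintro h ⟨hh, f₁, hf₁, hmax₁, hle⟩
    refine hmin.ae_eq_specChar_of_meanSqError_le hd (Set.mem_iInter₂.mp hh f₀ hf₀) ?_
    -- `Δ(h; f₀) ≤ Δ(h; f₁) ≤ sup_f Δ(h(f₀); f) ≤ Δ(h(f₀); f₀)`; the middle inequality compares the
    -- minimax `h` with the competitor `h(f₀)`.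
    exact (hmax₁ f₀ hf₀).trans ((hle _ hadm).trans (iSup₂_le hsaddle))
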